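/- Let $K$ be a field, let $0<n_1<n_2<n_3<n_4$ be integers with $\gcd(n_1,n_2,n_3,n_4)=1$, and let $C\subset\mathbb{A}^4(K)$ be the monomial curve $x_i=t^{n_i}$ ($1\le i\le 4$). Its toric ideal $I(C)$ is the kernel of the $K$-algebra homomorphism $K[x_1,\dots,x_4]\to K[t]$, $x_i\mapsto t^{n_i}$. For a polynomial $f$ let $f_*$ be its homogeneous summand of least degree, and let $I(C)_*$ be the ideal generated by all $f_*$ with $f\in I(C)$. Assume that $C$ has Cohen–Macaulay tangent cone at the origin, that is, that the ring $K[x_1,\dots,x_4]/I(C)_*$ is Cohen–Macaulay. Suppose that $I(C)$ is given as in case 3(b): there are integers $a_j$ and $a_{ij}$ with $0<a_{ij}<a_j$ such that $I(C)$ is minimally generated by $$f_1=x_1^{a_1}-x_2^{a_{12}}x_4^{a_{14}},\quad f_2=x_2^{a_2}-x_3^{a_{23}}x_4^{a_{24}},\quad f_3=x_3^{a_3}-x_1^{a_{31}}x_2^{a_{32}},$$ $$f_4=x_4^{a_4}-x_1^{a_{41}}x_3^{a_{43}},\quad f_5=x_1^{a_{31}}x_4^{a_{24}}-x_2^{a_{12}}x_3^{a_{43}}.$$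 Suppose moreover that $a_{23}<a_{43}$ and $a_{14}\le a_{24}$, and put $$f_6=x_2^{a_2+a_{12}}-x_1^{a_1}x_3^{a_{23}}x_4^{a_{24}-a_{14}}.$$ Then $\{f_1,\dots,f_6\}$ is a standard basis of $I(C)$ with respect to the negative degree reverse lexicographic term ordering with $x_4>x_3>x_2>x_1$; that is, it is contained in $I(C)$ and the leading monomials of $f_1,\dots,f_6$ generate the ideal generated by the leading monomials of all nonzero elements of $I(C)$. Moreover, the following hold. 1. If $a_3<a_{31}+a_{32}$, $a_2+a_{12}<a_1+a_{23}+a_{24}-a_{14}$ and $a_{12}+a_{43}<a_{31}+a_{24}$, then $I(C)_*$ is minimally generated by $\{x_2^{a_{12}}x_4^{a_{14}},\ x_3^{a_{23}}x_4^{a_{24}},\ x_3^{a_3},\ x_4^{a_4},\ x_2^{a_{12}}x_3^{a_{43}},\ x_2^{a_2+a_{12}}\}$. 2. If $a_3<a_{31}+a_{32}$, $a_2+a_{12}<a_1+a_{23}+a_{24}-a_{14}$ and $a_{12}+a_{43}=a_{31}+a_{24}$, then $I(C)_*$ is minimally generated by $\{x_2^{a_{12}}x_4^{a_{14}},\ x_3^{a_{23}}x_4^{a_{24}},\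 x_3^{a_3},\ x_4^{a_4},\ f_5,\ x_2^{a_2+a_{12}}\}$. 3. If $a_3<a_{31}+a_{32}$, $a_2+a_{12}=a_1+a_{23}+a_{24}-a_{14}$ and $a_{12}+a_{43}<a_{31}+a_{24}$, then $I(C)_*$ is minimally generated by $\{x_2^{a_{12}}x_4^{a_{14}},\ x_3^{a_{23}}x_4^{a_{24}},\ x_3^{a_3},\ x_4^{a_4},\ x_2^{a_{12}}x_3^{a_{43}},\ f_6\}$. 4. If $a_3<a_{31}+a_{32}$, $a_2+a_{12}=a_1+a_{23}+a_{24}-a_{14}$ and $a_{12}+a_{43}=a_{31}+a_{24}$, then $I(C)_*$ is minimally generated by $\{x_2^{a_{12}}x_4^{a_{14}},\ x_3^{a_{23}}x_4^{a_{24}},\ x_3^{a_3},\ x_4^{a_4},\ f_5,\ f_6\}$. 5. – 8. If $a_3=a_{31}+a_{32}$ and the other two conditions of case 1, 2, 3 or 4 respectively hold, then $I(C)_*$ is minimally generated by the same six elements as in case 1, 2, 3 or 4 respectively. Here an ideal is said to be minimally generated by a list of elements if they generate it and no one of them can be left out. -/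

import Mathlib

open MvPolynomial

/-! ### Monomial curves and their tangent cones -/

/-- The toric ideal `I(C)` of the monomial curve `x_i = t ^ n_i`: the kernel of the `K`-algebra
homomorphism `K[x_1, …, x_d] → K[t]`, `x_i ↦ t ^ n_i`. -/
noncomputable def toricIdeal (K : Type*) [Field K] {d : ℕ} (n : Fin d → ℕ) :
    Ideal (MvPolynomial (Fin d) K) :=
  RingHom.ker (aeval (fun i => (Polynomial.X : Polynomial K) ^ n i) :
    MvPolynomial (Fin d) K →ₐ[K] Polynomial K)

/-- The homogeneous summand `f_*` of `f` of least degree (it is `0` for `f = 0`). -/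
noncomputable def leastForm {K : Type*} [Field K] {d : ℕ} (f : MvPolynomial (Fin d) K) :
    MvPolynomial (Fin d) K :=
  homogeneousComponent (sInf {k : ℕ | homogeneousComponent k f ≠ 0}) f

/-- The ideal `I_*` generated by the `f_*`, for `f ∈ I`. -/
noncomputable def tangentConeIdeal {K : Type*} [Field K] {d : ℕ}
    (I : Ideal (MvPolynomial (Fin d) K)) : Ideal (MvPolynomial (Fin d) K) :=
  Ideal.span (leastForm '' (I : Set (MvPolynomial (Fin d) K)))

/-! ### Cohen-Macaulay rings -/

/-- The depth of a (Noetherian) local ring: the supremum of the lengths of the regular sequences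
that are contained in the maximal ideal. -/
noncomputable def localDepth (R : Type*) [CommRing R] [IsLocalRing R] : ℕ∞ :=
  ⨆ rs ∈ {rs : List R | RingTheory.Sequence.IsRegular R rs ∧
    ∀ r ∈ rs, r ∈ IsLocalRing.maximalIdeal R}, (rs.length : ℕ∞)

/-- A Noetherian ring is Cohen-Macaulay if depth and Krull dimension agree for its localization
at every prime ideal. -/
def IsCohenMacaulayRing (R : Type*) [CommRing R] : Prop :=
  IsNoetherianRing R ∧ ∀ (p : Ideal R) [p.IsPrime],
    (localDepth (Localization.AtPrime p) : WithBot ℕ∞) = ringKrullDim (Localization.AtPrime p)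

/-- The curve `x_i = t ^ n_i` has Cohen-Macaulay tangent cone at the origin: the coordinate ring
`K[x_1, …, x_d] / I(C)_*` of the tangent cone is Cohen-Macaulay. -/
def HasCohenMacaulayTangentCone (K : Type*) [Field K] {d : ℕ} (n : Fin d → ℕ) : Prop :=
  IsCohenMacaulayRing (MvPolynomial (Fin d) K ⧸ tangentConeIdeal (toricIdeal K n))

/-! ### Standard bases for the negative degree reverse lexicographic ordering -/

/-- `NegDegRevLexLT u v` says `x ^ u < x ^ v` in the negative degree reverse lexicographic
ordering with `x_d > ⋯ > x_2 > x_1` (a local ordering): either `x ^ u` has the larger degree, or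
the degrees agree and, at the smallest variable at which the exponents differ, `u` has the larger
exponent. (`Fin d` counts from `0`, so the smallest variable `x_1` has index `0`.) -/
def NegDegRevLexLT {d : ℕ} (u v : Fin d →₀ ℕ) : Prop :=
  v.degree < u.degree ∨
    (u.degree = v.degree ∧ ∃ i, (∀ j < i, u j = v j) ∧ v i < u i)

/-- `m` is the exponent of the leading monomial of `f` (there is none for `f = 0`). -/
def IsLeadingExponent {K : Type*} [Field K] {d : ℕ} (f : MvPolynomial (Fin d) K)
    (m : Fin d →₀ ℕ) : Prop :=
  m ∈ f.support ∧ ∀ u ∈ f.support, u ≠ m → NegDegRevLexLT u m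

/-- The ideal of `K[x_1, …, x_d]` generated by the leading monomials of the nonzero elements
of `S`. -/
noncomputable def leadingIdeal {K : Type*} [Field K] {d : ℕ} (S : Set (MvPolynomial (Fin d) K)) :
    Ideal (MvPolynomial (Fin d) K) :=
  Ideal.span {p | ∃ f ∈ S, ∃ m, IsLeadingExponent f m ∧ p = monomial m 1}

/-- `G` is a standard basis of the ideal `I` with respect to the negative degree reverse
lexicographic ordering with `x_d > ⋯ > x_1`. -/
def IsStandardBasis {K : Type*} [Field K] {d : ℕ} (I : Ideal (MvPolynomial (Fin d) K))
    (G : Set (MvPolynomial (Fin d) K)) : Prop :=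
  G.Finite ∧ G ⊆ I ∧ leadingIdeal (I : Set (MvPolynomial (Fin d) K)) = leadingIdeal G

/-! ### Minimal generation and the curves under consideration -/

/-- The ideal `I` is minimally generated by the family `g`: the `g i` generate `I`, and none of
them can be left out (in particular they are pairwise distinct). -/
def IsMinimallyGeneratedBy {R : Type*} [CommRing R] {r : ℕ} (I : Ideal R) (g : Fin r → R) : Prop :=
  Ideal.span (Set.range g) = I ∧ ∀ i, g i ∉ Ideal.span (g '' {j | j ≠ i})

/-- The exponents `a_j` and `a_ij` that occur in the generators of case 3(b). -/
structure Case3bExponents where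
  (a1 a2 a3 a4 a12 a14 a23 a24 a31 a32 a41 a43 : ℕ)

/-- `I(C)` is given as in case 3(b): it is minimally generated by
`f_1 = (1,(2,4))`, `f_2 = (2,(3,4))`, `f_3 = (3,(1,2))`, `f_4 = (4,(1,3))`, `f_5 = ((2,3),(1,4))`,
and `0 < a_ij < a_j`. The variables `x_1, …, x_4` are `X 0, …, X 3`. -/
structure IsCase3b (K : Type*) [Field K] (n : Fin 4 → ℕ) (e : Case3bExponents) : Prop where
  a12 : 0 < e.a12 ∧ e.a12 < e.a2
  a14 : 0 < e.a14 ∧ e.a14 < e.a4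
  a23 : 0 < e.a23 ∧ e.a23 < e.a3
  a24 : 0 < e.a24 ∧ e.a24 < e.a4
  a31 : 0 < e.a31 ∧ e.a31 < e.a1
  a32 : 0 < e.a32 ∧ e.a32 < e.a2
  a41 : 0 < e.a41 ∧ e.a41 < e.a1
  a43 : 0 < e.a43 ∧ e.a43 < e.a3
  minimallyGenerated : IsMinimallyGeneratedBy (toricIdeal K n)
    ![X 0 ^ e.a1 - X 1 ^ e.a12 * X 3 ^ e.a14,
      X 1 ^ e.a2 - X 2 ^ e.a23 * X 3 ^ e.a24,
      X 2 ^ e.a3 - X 0 ^ e.a31 * X 1 ^ e.a32,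
      X 3 ^ e.a4 - X 0 ^ e.a41 * X 2 ^ e.a43,
      X 0 ^ e.a31 * X 3 ^ e.a24 - X 1 ^ e.a12 * X 2 ^ e.a43]

/-! ### Newman's lemma -/

/-! The six binomials act as rewriting rules `lead i → tail i` on exponents. The rules preserve the
weight ∑ n_i u_i, terminate, are locally confluent, and join the two monomials of each given
generator of I(C). By `newman` all exponents of one weight then share a normal form
(`exists_normalForm`).

In an element f of I(C) the coefficients of each weight sum to zero. If the rules decrease the
ordering, a leading exponent cannot be the normal form of its weight, so some `lead i` divides it
(`leadingIdeal_toricIdeal_eq`). Replacing every monomial of f by its normal form gives zero; if the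
rules never lower the degree, comparing the parts of least degree puts f_* into the ideal of the
least forms of the rules (`tangentConeIdeal_toricIdeal_le`).

Local confluence rests on a_1 = a_31 + a_41 and its three analogues, which follow from the weights
(`relations`). The degree condition for f_1, …, f_4 follows from n_1 < ⋯ < n_4, strictly, so the
cases with a_3 = a_31 + a_32 are vacuous. For f_5 and f_6 it comes from Cohen–Macaulayness: x_1 is a
nonzerodivisor on the tangent cone at the origin. Were the tail of smaller degree, it would lie in
I(C)_*; cancelling its power of x_1 would leave a monomial divisible by no monomial of the
generators, which is impossible (`degreeRelations`). -/

theorem newman {α : Type*} {r : α → α → Prop} (hwf : WellFounded (flip r))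
    (hloc : ∀ a b c, r a b → r a c → Relation.Join (Relation.ReflTransGen r) b c)
    {a b c : α} (hab : Relation.ReflTransGen r a b) (hac : Relation.ReflTransGen r a c) :
    Relation.Join (Relation.ReflTransGen r) b c := by
  induction a using hwf.induction generalizing b c with
  | _ a ih =>
    rcases hab.cases_head with rfl | ⟨b₁, hb₁, hb⟩
    · exact ⟨c, hac, .refl⟩
    rcases hac.cases_head with rfl | ⟨c₁, hc₁, hc⟩
    · exact ⟨b, .refl, .head hb₁ hb⟩
    obtain ⟨d, hbd, hcd⟩ := hloc a b₁ c₁ hb₁ hc₁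
    obtain ⟨e, hbe, hde⟩ := ih b₁ hb₁ hb hbd
    obtain ⟨f, hcf, hef⟩ := ih c₁ hc₁ hc (hcd.trans hde)
    exact ⟨f, hbe.trans hef, hcf⟩

theorem exists_irreducible {α : Type*} {r : α → α → Prop} (hwf : WellFounded (flip r)) (a : α) :
    ∃ b, Relation.ReflTransGen r a b ∧ ∀ c, ¬ r b c := by
  induction a using hwf.induction with
  | _ a ih =>
    by_cases h : ∃ b, r a b
    · obtain ⟨b, hb⟩ := h
      obtain ⟨c, hbc, hc⟩ := ih b hb
      exact ⟨c, .head hb hbc, hc⟩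
    · exact ⟨a, .refl, not_exists.mp h⟩

/-! ### The toric ideal -/

section Toric

variable {K : Type*} [Field K] {d : ℕ} {n : Fin d → ℕ}

theorem aeval_X_pow_monomial (n : Fin d → ℕ) (u : Fin d →₀ ℕ) (c : K) :
    aeval (fun i => (Polynomial.X : Polynomial K) ^ n i) (monomial u c) =
      Polynomial.monomial (Finsupp.weight n u) c := by
  rw [aeval_monomial, Finsupp.prod_fintype _ _ (by simp), Finsupp.weight_eq_sum,
    ← Polynomial.C_mul_X_pow_eq_monomial, ← Finset.prod_pow_eq_pow_sum]
  simp [← pow_mul, mul_comm]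

/-- Apply the linear map t^w ↦ F w to the image of f in K[t], which is zero. A general target V
allows both indicator functions of a weight and normal form monomials as F. -/
theorem sum_smul_weight_eq_zero {V : Type*} [AddCommGroup V] [Module K V]
    {f : MvPolynomial (Fin d) K} (hf : f ∈ toricIdeal K n) (F : ℕ → V) :
    ∑ u ∈ f.support, coeff u f • F (Finsupp.weight n u) = 0 := by
  have h0 : aeval (fun i => (Polynomial.X : Polynomial K) ^ n i) f = 0 := hf
  rw [f.as_sum, map_sum] at h0
  simp_rw [aeval_X_pow_monomial] at h0
  have h1 := congrArg (fun p : Polynomial K => p.sum fun w c => c • F w) h0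
  simp only [Polynomial.sum_zero_index] at h1
  have hlin : ∀ s : Finset (Fin d →₀ ℕ),
      (∑ u ∈ s, Polynomial.monomial (Finsupp.weight n u) (coeff u f)).sum (fun w c => c • F w) =
        ∑ u ∈ s, coeff u f • F (Finsupp.weight n u) := by
    intro s
    classical
    induction s using Finset.induction_on with
    | empty => simp
    | insert a s ha ih =>
      rw [Finset.sum_insert ha, Finset.sum_insert ha,
        Polynomial.sum_add_index _ _ _ (by simp) (by intros; rw [add_smul]), ih,
        Polynomial.sum_monomial_index _ _ (by simp)]
  rw [← h1, hlin]

theorem monomial_sub_monomial_mem_toricIdeal {u v : Fin d →₀ ℕ} :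
    (monomial u 1 - monomial v 1 : MvPolynomial (Fin d) K) ∈ toricIdeal K n ↔
      Finsupp.weight n u = Finsupp.weight n v := by
  rw [toricIdeal, RingHom.mem_ker, map_sub]
  change aeval _ _ - aeval _ _ = _ ↔ _
  rw [aeval_X_pow_monomial, aeval_X_pow_monomial, sub_eq_zero]
  constructor
  · intro h
    simpa using (Polynomial.monomial_eq_monomial_iff).mp h
  · intro h; rw [h]

theorem exists_mem_support_ne_weight_eq {f : MvPolynomial (Fin d) K} (hf : f ∈ toricIdeal K n)
    {m : Fin d →₀ ℕ} (hm : m ∈ f.support) :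
    ∃ u ∈ f.support, u ≠ m ∧ Finsupp.weight n u = Finsupp.weight n m := by
  by_contra! h
  have := sum_smul_weight_eq_zero hf (fun w => if w = Finsupp.weight n m then (1 : K) else 0)
  rw [Finset.sum_eq_single m] at this
  · simp at this
    exact (mem_support_iff.mp hm) this
  · intro u hu hum
    simp [h u hu hum]
  · exact fun h => (h hm).elim

/-- The map from K[x] to the monoid algebra of ℕ^d / c kills the generators, hence also x^u - x^v.
Distinct classes are linearly independent there, so u and v have the same class. -/
theorem toricIdeal_addCon {ι : Type*} {L T : ι → Fin d →₀ ℕ}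
    (hI : toricIdeal K n =
      Ideal.span (Set.range fun i => monomial (L i) (1 : K) - monomial (T i) 1))
    (c : AddCon (Fin d →₀ ℕ)) (hc : ∀ i, c (L i) (T i)) {u v : Fin d →₀ ℕ}
    (h : Finsupp.weight n u = Finsupp.weight n v) : c u v := by
  let φ : MvPolynomial (Fin d) K →+* AddMonoidAlgebra K c.Quotient :=
    AddMonoidAlgebra.mapDomainRingHom K c.mk'
  have hφ : ∀ m, φ (monomial m 1) = AddMonoidAlgebra.single (c.mk' m) 1 := fun m =>
    AddMonoidAlgebra.mapDomain_single
  have hle : toricIdeal K n ≤ RingHom.ker φ := by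
    rw [hI, Ideal.span_le]
    rintro _ ⟨i, rfl⟩
    have : c.mk' (L i) = c.mk' (T i) := (AddCon.eq c).mpr (hc i)
    simp only [SetLike.mem_coe, RingHom.mem_ker, map_sub, hφ, this, sub_self]
  have h0 := hle (monomial_sub_monomial_mem_toricIdeal.mpr h)
  rw [RingHom.mem_ker, map_sub, hφ, hφ, sub_eq_zero] at h0
  have := (AddMonoidAlgebra.single_left_inj (one_ne_zero)).mp h0
  exact (AddCon.eq c).mp this

end Toric

/-! ### Rewriting of exponents -/

/-- `u` can be rewritten to `v` by one of the rules `L i → T i`. -/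
def RewriteStep {d : ℕ} {ι : Type*} (L T : ι → Fin d →₀ ℕ) (u v : Fin d →₀ ℕ) : Prop :=
  ∃ i r, u = L i + r ∧ v = T i + r

namespace RewriteStep

variable {d : ℕ} {ι : Type*} {L T : ι → Fin d →₀ ℕ}

theorem rule (i : ι) : RewriteStep L T (L i) (T i) := ⟨i, 0, by simp, by simp⟩

theorem add_right {u v : Fin d →₀ ℕ} (h : RewriteStep L T u v) (w : Fin d →₀ ℕ) :
    RewriteStep L T (u + w) (v + w) := by
  obtain ⟨i, r, rfl, rfl⟩ := h
  exact ⟨i, r + w, by rw [add_assoc], by rw [add_assoc]⟩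

theorem reflTransGen_add_right {u v : Fin d →₀ ℕ}
    (h : Relation.ReflTransGen (RewriteStep L T) u v) (w : Fin d →₀ ℕ) :
    Relation.ReflTransGen (RewriteStep L T) (u + w) (v + w) :=
  h.lift (· + w) fun _ _ h => h.add_right w

/-- Joinability under a confluent system of rules is a congruence. -/
def joinCon (hconf : ∀ u v w, Relation.ReflTransGen (RewriteStep L T) u v →
      Relation.ReflTransGen (RewriteStep L T) u w →
      Relation.Join (Relation.ReflTransGen (RewriteStep L T)) v w) :
    AddCon (Fin d →₀ ℕ) where
  r := Relation.Join (Relation.ReflTransGen (RewriteStep L T))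
  iseqv := Relation.equivalence_join (r := Relation.ReflTransGen (RewriteStep L T)) hconf
  add' := by
    rintro a b a' b' ⟨c, hac, hbc⟩ ⟨c', hac', hbc'⟩
    refine ⟨c + c', (reflTransGen_add_right hac _).trans ?_,
      (reflTransGen_add_right hbc _).trans ?_⟩
    · simpa only [add_comm] using reflTransGen_add_right hac' c
    · simpa only [add_comm] using reflTransGen_add_right hbc' c

end RewriteStep

/-- A terminating and locally confluent system of rules that joins both monomials of each of the
binomial generators of a toric ideal yields one normal form for each weight. -/
theorem exists_normalForm {K : Type*} [Field K] {d : ℕ} {n : Fin d → ℕ} {ι κ : Type*}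
    {L T : ι → Fin d →₀ ℕ} {A B : κ → Fin d →₀ ℕ}
    (hI : toricIdeal K n =
      Ideal.span (Set.range fun i => monomial (A i) (1 : K) - monomial (B i) 1))
    (hAB : ∀ i, Relation.Join (Relation.ReflTransGen (RewriteStep L T)) (A i) (B i))
    (hwf : WellFounded (flip (RewriteStep L T)))
    (hloc : ∀ a b c, RewriteStep L T a b → RewriteStep L T a c →
      Relation.Join (Relation.ReflTransGen (RewriteStep L T)) b c) :
    ∃ nf : ℕ → (Fin d →₀ ℕ), ∀ u,
      Relation.ReflTransGen (RewriteStep L T) u (nf (Finsupp.weight n u)) := by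
  have key : ∀ w, ∃ m, ∀ u : Fin d →₀ ℕ, Finsupp.weight n u = w →
      Relation.ReflTransGen (RewriteStep L T) u m := by
    intro w
    by_cases hw : ∃ v : Fin d →₀ ℕ, Finsupp.weight n v = w
    · obtain ⟨v, hv⟩ := hw
      obtain ⟨m, hvm, hm⟩ := exists_irreducible hwf v
      refine ⟨m, fun u hu => ?_⟩
      have hcon := toricIdeal_addCon hI
        (RewriteStep.joinCon fun u v w => newman hwf hloc) hAB (hu.trans hv.symm)
      obtain ⟨p, hup, hvp⟩ := hcon
      obtain ⟨q, hmq, hpq⟩ := newman hwf hloc hvm hvp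
      rcases hmq.cases_head with rfl | ⟨c, hc, -⟩
      · exact hup.trans hpq
      · exact (hm c hc).elim
    -- A weight that no exponent attains gets the default value 0.
    · exact ⟨0, fun u hu => (hw ⟨u, hu⟩).elim⟩
  choose nf hnf using key
  exact ⟨nf, fun u => hnf _ u rfl⟩

/-! ### The negative degree reverse lexicographic ordering -/

namespace NegDegRevLexLT

variable {d : ℕ} {u v w : Fin d →₀ ℕ}

theorem irrefl (u : Fin d →₀ ℕ) : ¬ NegDegRevLexLT u u := by
  rintro (h | ⟨-, i, -, h⟩) <;> exact lt_irrefl _ h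

theorem trans (h₁ : NegDegRevLexLT u v) (h₂ : NegDegRevLexLT v w) : NegDegRevLexLT u w := by
  rcases h₁ with h₁ | ⟨h₁, i, hi, hi'⟩ <;> rcases h₂ with h₂ | ⟨h₂, j, hj, hj'⟩
  · exact .inl (h₂.trans h₁)
  · exact .inl (h₂ ▸ h₁)
  · exact .inl (h₁ ▸ h₂)
  · refine .inr ⟨h₁.trans h₂, min i j, fun k hk => ?_, ?_⟩
    · rw [hi k (hk.trans_le (min_le_left _ _)), hj k (hk.trans_le (min_le_right _ _))]
    · rcases lt_trichotomy i j with h | rfl | h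
      · rw [min_eq_left h.le, ← hj i h]; exact hi'
      · rw [min_self]; exact hj'.trans hi'
      · rw [min_eq_right h.le, hi j h]; exact hj'

theorem add_right (h : NegDegRevLexLT u v) (w : Fin d →₀ ℕ) : NegDegRevLexLT (u + w) (v + w) := by
  rcases h with h | ⟨h, i, hi, hi'⟩
  · exact .inl (by simpa using h)
  · exact .inr ⟨by simpa using h, i, fun j hj => by simp [hi j hj], by simpa using hi'⟩

end NegDegRevLexLT

theorem eq_or_lt_of_reflTransGen {d : ℕ} {ι : Type*} {L T : ι → Fin d →₀ ℕ}
    (hlt : ∀ i, NegDegRevLexLT (T i) (L i)) {u v : Fin d →₀ ℕ}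
    (h : Relation.ReflTransGen (RewriteStep L T) u v) : v = u ∨ NegDegRevLexLT v u := by
  induction h with
  | refl => exact .inl rfl
  | tail _ h ih =>
    obtain ⟨i, r, rfl, rfl⟩ := h
    have h1 := (hlt i).add_right r
    rcases ih with ih | ih
    · exact .inr (ih ▸ h1)
    · exact .inr (h1.trans ih)

/-- If every exponent rewrites to the normal form of its weight by rules that decrease the
ordering, then the left hand sides of the rules generate the leading ideal. -/
theorem leadingIdeal_toricIdeal_eq {K : Type*} [Field K] {d : ℕ} {n : Fin d → ℕ} {ι : Type*}
    {L T : ι → Fin d →₀ ℕ} (hlt : ∀ i, NegDegRevLexLT (T i) (L i))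
    {nf : ℕ → (Fin d →₀ ℕ)}
    (hnf : ∀ u, Relation.ReflTransGen (RewriteStep L T) u (nf (Finsupp.weight n u)))
    {G : Set (MvPolynomial (Fin d) K)} (hG : G ⊆ toricIdeal K n)
    (hL : ∀ i, ∃ f ∈ G, IsLeadingExponent f (L i)) :
    leadingIdeal (toricIdeal K n : Set (MvPolynomial (Fin d) K)) = leadingIdeal G := by
  apply le_antisymm
  · refine Ideal.span_le.mpr ?_
    rintro _ ⟨f, hf, m, ⟨hm, hmax⟩, rfl⟩
    rcases (hnf m).cases_head with h | ⟨v, ⟨i, r, hi, -⟩, -⟩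
    -- Here m is its own normal form. Another exponent u of f with the same weight rewrites to m, so
    -- m is smaller than u, although m is leading.
    · obtain ⟨u, hu, hum, hw⟩ := exists_mem_support_ne_weight_eq hf hm
      have h1 := hmax u hu hum
      have h2 := hnf u
      rw [hw, ← h] at h2
      rcases eq_or_lt_of_reflTransGen hlt h2 with h3 | h3
      · exact (hum h3.symm).elim
      · exact (NegDegRevLexLT.irrefl _ (h1.trans h3)).elim
    · obtain ⟨g, hg, hgL⟩ := hL i
      have : (monomial m 1 : MvPolynomial (Fin d) K) = monomial r 1 * monomial (L i) 1 := by
        rw [monomial_mul, hi, add_comm, one_mul]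
      rw [SetLike.mem_coe, this]
      exact Ideal.mul_mem_left _ _ (Ideal.subset_span ⟨g, hg, L i, hgL, rfl⟩)
  · refine Ideal.span_mono ?_
    rintro _ ⟨f, hf, m, hm, rfl⟩
    exact ⟨f, hG hf, m, hm, rfl⟩

/-! ### Least forms and the tangent cone -/

section LeastForm

variable {K : Type*} [Field K] {d : ℕ}

theorem leastForm_eq {f : MvPolynomial (Fin d) K} {k : ℕ} (h : homogeneousComponent k f ≠ 0)
    (hlt : ∀ u ∈ f.support, k ≤ u.degree) : leastForm f = homogeneousComponent k f := by
  have : sInf {k : ℕ | homogeneousComponent k f ≠ 0} = k := by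
    refine le_antisymm (Nat.sInf_le h) (le_csInf ⟨k, h⟩ fun j hj => ?_)
    by_contra! hjk
    refine hj (homogeneousComponent_eq_zero' _ _ fun u hu => ?_)
    exact fun h => absurd (hlt u hu) (by omega)
  rw [leastForm, this]

theorem exists_leastForm_eq (f : MvPolynomial (Fin d) K) :
    ∃ k, leastForm f = homogeneousComponent k f ∧ ∀ u ∈ f.support, k ≤ u.degree := by
  refine ⟨_, rfl, fun u hu => Nat.sInf_le fun h => ?_⟩
  have := congrArg (coeff u) h
  rw [coeff_homogeneousComponent, if_pos rfl] at this
  exact mem_support_iff.mp hu (by simpa using this)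

theorem leastForm_zero : leastForm (0 : MvPolynomial (Fin d) K) = 0 := by
  simp [leastForm]

theorem mem_support_of_mem_support_leastForm {f : MvPolynomial (Fin d) K} {u : Fin d →₀ ℕ}
    (hu : u ∈ (leastForm f).support) :
    u ∈ f.support ∧ ∀ v ∈ f.support, u.degree ≤ v.degree := by
  obtain ⟨k, hk, hmin⟩ := exists_leastForm_eq f
  rw [hk, mem_support_iff, coeff_homogeneousComponent] at hu
  split_ifs at hu with h
  · exact ⟨mem_support_iff.mpr hu, fun v hv => h ▸ hmin v hv⟩
  · exact (hu rfl).elim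

theorem leastForm_monomial_sub_of_lt {u v : Fin d →₀ ℕ} (h : u.degree < v.degree) :
    leastForm (monomial u 1 - monomial v 1 : MvPolynomial (Fin d) K) = monomial u 1 := by
  have hc : homogeneousComponent u.degree (monomial u 1 - monomial v 1 : MvPolynomial (Fin d) K) =
      monomial u 1 := by
    rw [map_sub, homogeneousComponent_of_mem (isHomogeneous_monomial _ rfl),
      homogeneousComponent_of_mem (isHomogeneous_monomial _ rfl), if_pos rfl, if_neg h.ne, sub_zero]
  rw [leastForm_eq (k := u.degree), hc]
  · rw [hc]; simp
  · intro m hm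
    classical
    rcases Finset.mem_union.mp (support_sub _ _ _ hm) with h' | h' <;>
      rw [Finset.mem_singleton.mp (support_monomial_subset h')]
    exact h.le

theorem leastForm_monomial_sub_of_eq {u v : Fin d →₀ ℕ} (h : u.degree = v.degree) :
    leastForm (monomial u 1 - monomial v 1 : MvPolynomial (Fin d) K) =
      monomial u 1 - monomial v 1 := by
  rcases eq_or_ne u v with rfl | huv
  · simp [leastForm_zero]
  have hc : homogeneousComponent u.degree (monomial u 1 - monomial v 1 : MvPolynomial (Fin d) K) =
      monomial u 1 - monomial v 1 := by
    rw [map_sub, homogeneousComponent_of_mem (isHomogeneous_monomial _ rfl),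
      homogeneousComponent_of_mem (isHomogeneous_monomial _ rfl), if_pos rfl, if_pos h]
  rw [leastForm_eq (k := u.degree), hc]
  · rw [hc, sub_ne_zero]
    exact fun h => huv (monomial_left_injective one_ne_zero h)
  · intro m hm
    classical
    rcases Finset.mem_union.mp (support_sub _ _ _ hm) with h' | h' <;>
      rw [Finset.mem_singleton.mp (support_monomial_subset h')]
    exact h.le

/-- An ideal that contains the least forms of all rules of a rewriting system with one normal form
for each weight contains the tangent cone ideal. -/
theorem tangentConeIdeal_toricIdeal_le {n : Fin d → ℕ} {ι : Type*}
    {L T : ι → Fin d →₀ ℕ} {nf : ℕ → (Fin d →₀ ℕ)}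
    (hnf : ∀ u, Relation.ReflTransGen (RewriteStep L T) u (nf (Finsupp.weight n u)))
    {Q : Ideal (MvPolynomial (Fin d) K)}
    (hQ : ∀ i, (L i).degree < (T i).degree ∧ monomial (L i) 1 ∈ Q ∨
      (L i).degree = (T i).degree ∧ monomial (L i) 1 - monomial (T i) 1 ∈ Q) :
    tangentConeIdeal (toricIdeal K n) ≤ Q := by
  -- Along a rewriting path the degree never falls. Modulo Q the monomial stays the same while the
  -- degree is constant, and it vanishes if the degree ever rises.
  have hred : ∀ u v : Fin d →₀ ℕ, Relation.ReflTransGen (RewriteStep L T) u v →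
      u.degree < v.degree ∧ (monomial u 1 : MvPolynomial (Fin d) K) ∈ Q ∨
      u.degree = v.degree ∧ (monomial u 1 - monomial v 1 : MvPolynomial (Fin d) K) ∈ Q := by
    intro u v h
    induction h using Relation.ReflTransGen.head_induction_on with
    | refl => exact .inr ⟨rfl, by simp⟩
    | @head a b h _ ih =>
      obtain ⟨i, r, rfl, rfl⟩ := h
      have hm : ∀ m : Fin d →₀ ℕ, (monomial (m + r) 1 : MvPolynomial (Fin d) K) =
          monomial m 1 * monomial r 1 := fun m => by rw [monomial_mul, one_mul]
      simp only [hm, map_add] at ih ⊢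
      have hmul := fun x (hx : x ∈ Q) => Q.mul_mem_right (monomial r (1 : K)) hx
      rcases hQ i with ⟨h1, h2⟩ | ⟨h1, h2⟩
      · refine .inl ⟨?_, hmul _ h2⟩
        rcases ih with ih | ih <;> have := ih.1 <;> omega
      · have h3 := hmul _ h2
        rw [sub_mul] at h3
        rcases ih with ⟨h4, h5⟩ | ⟨h4, h5⟩
        · refine .inl ⟨by omega, ?_⟩
          simpa using Q.add_mem h3 h5
        · refine .inr ⟨by omega, ?_⟩
          simpa using Q.add_mem h3 h5
  refine Ideal.span_le.mpr ?_
  rintro _ ⟨f, hf, rfl⟩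
  obtain ⟨k, hk, hmin⟩ := exists_leastForm_eq f
  -- Subtracting this vanishing sum from the least form pairs each x^u with its normal form, both
  -- cut off outside degree k.
  have h0 := sum_smul_weight_eq_zero hf
    (fun w => if (nf w).degree = k then (monomial (nf w) 1 : MvPolynomial (Fin d) K) else 0)
  have hlf : leastForm f =
      ∑ u ∈ f.support, coeff u f • if u.degree = k then monomial u (1 : K) else 0 := by
    rw [hk, homogeneousComponent_apply, Finset.sum_filter]
    refine Finset.sum_congr rfl fun u _ => ?_
    split_ifs <;> simp [smul_monomial]
  rw [SetLike.mem_coe, ← sub_zero (leastForm f), hlf]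
  nth_rewrite 2 [← h0]
  rw [← Finset.sum_sub_distrib]
  refine Q.sum_mem fun u hu => ?_
  rw [← smul_sub, smul_eq_C_mul]
  refine Q.mul_mem_left _ ?_
  have hku := hmin u hu
  rcases hred _ _ (hnf u) with ⟨h1, h2⟩ | ⟨h1, h2⟩
  · rw [if_neg (by omega : ¬ (nf (Finsupp.weight n u)).degree = k), sub_zero]
    split_ifs
    · exact h2
    · exact Q.zero_mem
  · rw [← h1]
    split_ifs
    · exact h2
    · simp

end LeastForm

/-! ### Monomial ideals and minimal generation -/

section Monomial

variable {K : Type*} [Field K] {σ : Type*}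

theorem exists_le_of_mem_span {S : Set (MvPolynomial σ K)} {D : Set (σ →₀ ℕ)}
    (hS : ∀ f ∈ S, ∀ u ∈ f.support, ∃ m ∈ D, m ≤ u) {f : MvPolynomial σ K}
    (hf : f ∈ Ideal.span S) : ∀ u ∈ f.support, ∃ m ∈ D, m ≤ u := by
  rw [← mem_ideal_span_monomial_image]
  exact Ideal.span_le.mpr (fun g hg => mem_ideal_span_monomial_image.mpr (hS g hg)) hf

/-- If g i were in the span of the others, each of its monomials, `l i` among them, would be
divisible by a monomial from some D j with j ≠ i. D j may be larger than the support of g j. -/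
theorem notMem_span_image_of_support {r : ℕ} {g : Fin r → MvPolynomial σ K}
    (D : Fin r → Set (σ →₀ ℕ)) (hD : ∀ i, ∀ u ∈ (g i).support, u ∈ D i) (l : Fin r → σ →₀ ℕ)
    (hl : ∀ i, l i ∈ (g i).support) (hdiv : ∀ i j, j ≠ i → ∀ m ∈ D j, ¬ m ≤ l i) (i : Fin r) :
    g i ∉ Ideal.span (g '' {j | j ≠ i}) := by
  intro h
  obtain ⟨m, ⟨j, hj, hm⟩, hle⟩ := exists_le_of_mem_span (D := {m | ∃ j, j ≠ i ∧ m ∈ D j})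
    (by rintro _ ⟨j, hj, rfl⟩ u hu; exact ⟨u, ⟨j, hj, hD j u hu⟩, le_rfl⟩) h (l i) (hl i)
  exact hdiv i j hj m hm hle

end Monomial

/-! ### Cohen-Macaulay tangent cones -/

section CohenMacaulay

/-- In a local ring of equal depth and dimension, a non-nilpotent element `x` modulo which the maximal
ideal is nil is a nonzerodivisor. -/
theorem isSMulRegular_of_depth_eq_dim {R : Type*} [CommRing R] [IsLocalRing R]
    (hdepth : (localDepth R : WithBot ℕ∞) = ringKrullDim R) {x : R}
    (hx : x ∈ IsLocalRing.maximalIdeal R) (hnil : ¬ IsNilpotent x)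
    (hrad : IsLocalRing.maximalIdeal R ≤ (Ideal.span {x}).radical) : IsSMulRegular R x := by
  -- Depth zero would mean dimension zero, where the whole maximal ideal is nilpotent.
  have hpos : localDepth R ≠ 0 := by
    intro h0
    have : Ring.KrullDimLE 0 R := by
      rw [Ring.krullDimLE_iff, ← hdepth, h0]; rfl
    exact hnil (Ring.KrullDimLE.isNilpotent_iff_mem_maximalIdeal.mpr hx)
  have hr : ∃ r ∈ IsLocalRing.maximalIdeal R, IsSMulRegular R r := by
    by_contra! h
    refine hpos (le_antisymm (iSup₂_le fun rs hrs => ?_) bot_le)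
    rcases rs with _ | ⟨r, rs⟩
    · simp
    · exact (h r (hrs.2 r (by simp))
        ((RingTheory.Sequence.isRegular_cons_iff R r rs).mp hrs.1).1).elim
  obtain ⟨r, hrm, hr⟩ := hr
  rw [isSMulRegular_iff_right_eq_zero_of_smul]
  intro y hy
  -- A power of the regular element r is a multiple of x, so whatever x kills is killed by that
  -- power and is zero.
  obtain ⟨N, hN⟩ := hrad hrm
  obtain ⟨c, hc⟩ := Ideal.mem_span_singleton'.mp hN
  refine (hr.pow N).right_eq_zero_of_smul ?_
  rw [smul_eq_mul] at hy ⊢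
  rw [← hc, mul_assoc, hy, mul_zero]

variable {K : Type*} [Field K] {d : ℕ} {n : Fin d → ℕ} {o : Fin d}

/-- No pure power of x_o occurs in a least form: another monomial of f with the same weight has at
least the same degree, and as n_o is the strictly smallest weight, it would have to be the same
power of x_o. -/
theorem exists_ne_zero_of_mem_tangentConeIdeal (hpos : 0 < n o) (hmin : ∀ i, i ≠ o → n o < n i)
    {p : MvPolynomial (Fin d) K} (hp : p ∈ tangentConeIdeal (toricIdeal K n)) :
    ∀ u ∈ p.support, ∃ i ∈ ({o}ᶜ : Set (Fin d)), (u : Fin d →₀ ℕ) i ≠ 0 := by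
  rw [← mem_ideal_span_X_image]
  refine Ideal.span_le.mpr ?_ hp
  rintro _ ⟨f, hf, rfl⟩
  rw [SetLike.mem_coe, mem_ideal_span_X_image]
  intro u hu
  by_contra! hu0
  obtain ⟨huf, hdeg⟩ := mem_support_of_mem_support_leastForm hu
  obtain ⟨v, hv, hvu, hw⟩ := exists_mem_support_ne_weight_eq hf huf
  have hd := hdeg v hv
  rw [Finsupp.degree_eq_sum, Finsupp.degree_eq_sum] at hd
  rw [Finsupp.weight_eq_sum, Finsupp.weight_eq_sum] at hw
  simp only [smul_eq_mul] at hw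
  have hw' : ∑ i, u i * n i = (∑ i, u i) * n o := by
    rw [Finset.sum_mul]
    refine Finset.sum_congr rfl fun i _ => ?_
    by_cases hi : i = o
    · rw [hi]
    · simp [hu0 i hi]
  have hle : ∀ i, v i * n o ≤ v i * n i := fun i => by
    by_cases hi : i = o
    · rw [hi]
    · exact Nat.mul_le_mul_left _ (hmin i hi).le
  have hsum : ∑ i, v i * n i = ∑ i, v i * n o := by
    refine le_antisymm ?_ (Finset.sum_le_sum fun i _ => hle i)
    rw [hw, hw', ← Finset.sum_mul]
    exact Nat.mul_le_mul_right _ hd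
  have heq := (Finset.sum_eq_sum_iff_of_le fun i _ => hle i).mp hsum.symm
  have hv0 : ∀ i, i ≠ o → v i = 0 := fun i hi => by
    have := heq i (Finset.mem_univ i)
    by_contra hvi
    exact (hmin i hi).ne (Nat.eq_of_mul_eq_mul_left (Nat.pos_of_ne_zero hvi) this)
  have hsame : ∑ i, v i = ∑ i, u i := by
    rw [hsum, ← Finset.sum_mul, hw'] at hw
    exact Nat.eq_of_mul_eq_mul_right hpos hw
  rw [Finset.sum_eq_single o (fun i _ hi => hv0 i hi) (by simp),
    Finset.sum_eq_single o (fun i _ hi => hu0 i hi) (by simp)] at hsame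
  refine hvu (Finsupp.ext fun i => ?_)
  by_cases hi : i = o
  · rw [hi, hsame]
  · rw [hv0 i hi, hu0 i hi]

theorem X_pow_mem_tangentConeIdeal (hmin : ∀ i, i ≠ o → n o < n i) {i : Fin d} (hi : i ≠ o) :
    (X i ^ n o : MvPolynomial (Fin d) K) ∈ tangentConeIdeal (toricIdeal K n) := by
  have hmem : (monomial (Finsupp.single i (n o)) 1 - monomial (Finsupp.single o (n i)) 1 :
      MvPolynomial (Fin d) K) ∈ toricIdeal K n := by
    rw [monomial_sub_monomial_mem_toricIdeal, Finsupp.weight_single, Finsupp.weight_single,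
      smul_eq_mul, smul_eq_mul, mul_comm]
  have := Ideal.subset_span (Set.mem_image_of_mem leastForm hmem)
  rwa [leastForm_monomial_sub_of_lt (by simpa using hmin i hi), ← X_pow_eq_monomial] at this

/-- In the local ring of the tangent cone at the origin no power of x_o vanishes, while a power of
every other variable does. So `isSMulRegular_of_depth_eq_dim` makes x_o regular; the factor s clears
the localization. -/
theorem exists_mul_mem_tangentConeIdeal (hCM : HasCohenMacaulayTangentCone K n) (hpos : 0 < n o)
    (hmin : ∀ i, i ≠ o → n o < n i) {k : ℕ} {g : MvPolynomial (Fin d) K}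
    (hg : X o ^ k * g ∈ tangentConeIdeal (toricIdeal K n)) :
    ∃ s, constantCoeff s ≠ 0 ∧ s * g ∈ tangentConeIdeal (toricIdeal K n) := by
  set J := tangentConeIdeal (toricIdeal K n) with hJ
  have hJ0 : ∀ p ∈ J, constantCoeff p = 0 := by
    intro p hp
    by_contra h
    obtain ⟨i, -, hi⟩ := exists_ne_zero_of_mem_tangentConeIdeal hpos hmin hp 0
      (mem_support_iff.mpr h)
    exact hi rfl
  let ψ : MvPolynomial (Fin d) K ⧸ J →+* K := Ideal.Quotient.lift J constantCoeff hJ0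
  let p : Ideal (MvPolynomial (Fin d) K ⧸ J) := RingHom.ker ψ
  have hp : p.IsPrime := RingHom.ker_isPrime ψ
  let q : MvPolynomial (Fin d) K →+* Localization.AtPrime p :=
    (algebraMap _ (Localization.AtPrime p)).comp (Ideal.Quotient.mk J)
  have hq : ∀ f, q f = 0 ↔ ∃ s, constantCoeff s ≠ 0 ∧ s * f ∈ J := by
    intro f
    rw [RingHom.comp_apply, IsLocalization.map_eq_zero_iff p.primeCompl]
    constructor
    · rintro ⟨⟨s, hs⟩, h⟩
      obtain ⟨s, rfl⟩ := Ideal.Quotient.mk_surjective s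
      exact ⟨s, fun h0 => hs h0, by rwa [← map_mul, Ideal.Quotient.eq_zero_iff_mem] at h⟩
    · rintro ⟨s, hs, h⟩
      exact ⟨⟨Ideal.Quotient.mk J s, fun h0 => hs h0⟩, by
        rwa [← map_mul, Ideal.Quotient.eq_zero_iff_mem]⟩
  have hmax : IsLocalRing.maximalIdeal (Localization.AtPrime p) =
      Ideal.map q (idealOfVars (Fin d) K) := by
    rw [← Localization.AtPrime.map_eq_maximalIdeal, ← Ideal.map_map]
    congr 1
    apply le_antisymm
    · intro f hf
      obtain ⟨f, rfl⟩ := Ideal.Quotient.mk_surjective f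
      refine Ideal.mem_map_of_mem _ ?_
      have hf : constantCoeff f = 0 := hf
      rw [idealOfVars, ← Set.image_univ, mem_ideal_span_X_image]
      intro m hm
      by_contra! h
      have : m = 0 := Finsupp.ext fun i => h i trivial
      subst this
      exact mem_support_iff.mp hm hf
    · rw [Ideal.map_le_iff_le_comap, idealOfVars, Ideal.span_le]
      rintro _ ⟨i, rfl⟩
      change constantCoeff (X i) = 0
      simp
  have hreg : IsSMulRegular (Localization.AtPrime p) (q (X o)) := by
    refine isSMulRegular_of_depth_eq_dim (hCM.2 p) ?_ ?_ ?_
    · rw [hmax]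
      exact Ideal.mem_map_of_mem _ (Ideal.subset_span ⟨o, rfl⟩)
    · rintro ⟨N, hN⟩
      rw [← map_pow, hq] at hN
      obtain ⟨s, hs, hN⟩ := hN
      obtain ⟨i, hi, hi0⟩ := exists_ne_zero_of_mem_tangentConeIdeal hpos hmin hN
        (Finsupp.single o N) (by
          rw [mem_support_iff, X_pow_eq_monomial]
          have := coeff_mul_monomial 0 (Finsupp.single o N) (1 : K) s
          rw [zero_add, mul_one] at this
          rwa [this])
      exact hi0 (Finsupp.single_eq_of_ne hi)
    · rw [hmax, Ideal.map_le_iff_le_comap, idealOfVars, Ideal.span_le]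
      rintro _ ⟨i, rfl⟩
      by_cases hi : i = o
      · subst hi
        exact Ideal.le_radical (Ideal.mem_span_singleton_self _)
      · refine ⟨n o, ?_⟩
        have h0 : q (X i ^ n o) = 0 :=
          (hq _).mpr ⟨1, by simp, by rw [one_mul]; exact X_pow_mem_tangentConeIdeal hmin hi⟩
        rw [← map_pow, h0]
        exact Ideal.zero_mem _
  rw [← hq]
  refine (hreg.pow k).right_eq_zero_of_smul ?_
  rw [smul_eq_mul, ← map_pow, ← map_mul, hq]
  exact ⟨1, by simp, by rwa [one_mul]⟩

/-- If `x_o ^ k x ^ u` lies in a Cohen-Macaulay tangent cone ideal, then `x ^ u` lies in each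
monomial ideal that contains the toric ideal. -/
theorem exists_le_of_add_single_mem_tangentConeIdeal (hCM : HasCohenMacaulayTangentCone K n)
    (hpos : 0 < n o) (hmin : ∀ i, i ≠ o → n o < n i) {D : Set (Fin d →₀ ℕ)}
    (hD : ∀ f ∈ toricIdeal K n, ∀ u ∈ f.support, ∃ m ∈ D, m ≤ u) {k : ℕ} {u : Fin d →₀ ℕ}
    (hu : X o ^ k * monomial u 1 ∈ tangentConeIdeal (toricIdeal K n)) : ∃ m ∈ D, m ≤ u := by
  obtain ⟨s, hs, h⟩ := exists_mul_mem_tangentConeIdeal hCM hpos hmin hu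
  refine exists_le_of_mem_span 
    (S := leastForm '' (toricIdeal K n : Set (MvPolynomial (Fin d) K))) ?_ h u ?_
  · rintro _ ⟨f, hf, rfl⟩ v hv
    exact hD f hf v (mem_support_of_mem_support_leastForm hv).1
  -- The coefficient of x^u in s x^u is the constant term of s.
  · rw [mem_support_iff]
    have := coeff_mul_monomial 0 u (1 : K) s
    rw [zero_add, mul_one] at this
    rwa [this]

end CohenMacaulay

/-! ### Exponents in four variables -/

/-- The exponent `(a, b, c, d)` of a monomial in four variables. -/
noncomputable def fourExp (a b c d : ℕ) : Fin 4 →₀ ℕ := Finsupp.equivFunOnFinite.symm ![a, b, c, d]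

section FourExp

variable (a b c d : ℕ)

@[simp] theorem fourExp_zero : fourExp a b c d 0 = a := rfl
@[simp] theorem fourExp_one : fourExp a b c d 1 = b := rfl
@[simp] theorem fourExp_two : fourExp a b c d 2 = c := rfl
@[simp] theorem fourExp_three : fourExp a b c d 3 = d := rfl

theorem degree_fourExp : (fourExp a b c d).degree = a + b + c + d := by
  rw [Finsupp.degree_eq_sum, Fin.sum_univ_four]; rfl

theorem weight_fourExp (n : Fin 4 → ℕ) :
    Finsupp.weight n (fourExp a b c d) = a * n 0 + b * n 1 + c * n 2 + d * n 3 := by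
  rw [Finsupp.weight_eq_sum, Fin.sum_univ_four]; rfl

theorem monomial_fourExp {K : Type*} [Field K] :
    (monomial (fourExp a b c d) 1 : MvPolynomial (Fin 4) K) =
      X 0 ^ a * X 1 ^ b * X 2 ^ c * X 3 ^ d := by
  rw [monomial_eq, Finsupp.prod_fintype _ _ (by simp), Fin.prod_univ_four]
  simp

theorem four_ext_iff {u v : Fin 4 →₀ ℕ} :
    u = v ↔ u 0 = v 0 ∧ u 1 = v 1 ∧ u 2 = v 2 ∧ u 3 = v 3 := by
  rw [Finsupp.ext_iff]; simp [Fin.forall_fin_succ]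

theorem four_le_iff {u v : Fin 4 →₀ ℕ} :
    u ≤ v ↔ u 0 ≤ v 0 ∧ u 1 ≤ v 1 ∧ u 2 ≤ v 2 ∧ u 3 ≤ v 3 := by
  rw [Finsupp.le_def]; simp [Fin.forall_fin_succ]

end FourExp

/-! ### Binomials -/

section Binomial

variable {K : Type*} [Field K] {σ : Type*} {u v : σ →₀ ℕ}

theorem mem_support_monomial_sub {m : σ →₀ ℕ}
    (hm : m ∈ (monomial u 1 - monomial v 1 : MvPolynomial σ K).support) : m = u ∨ m = v := by
  classical
  rcases Finset.mem_union.mp (support_sub _ _ _ hm) with h | h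
  · exact .inl (Finset.mem_singleton.mp (support_monomial_subset h))
  · exact .inr (Finset.mem_singleton.mp (support_monomial_subset h))

theorem left_mem_support_monomial_sub (h : u ≠ v) :
    u ∈ (monomial u 1 - monomial v 1 : MvPolynomial σ K).support := by
  classical
  simp [mem_support_iff, coeff_monomial, h.symm]

theorem right_mem_support_monomial_sub (h : u ≠ v) :
    v ∈ (monomial u 1 - monomial v 1 : MvPolynomial σ K).support := by
  classical
  simp [mem_support_iff, coeff_monomial, h]

theorem isLeadingExponent_monomial_sub {d : ℕ} {u v : Fin d →₀ ℕ} (h : NegDegRevLexLT v u) :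
    IsLeadingExponent (monomial u 1 - monomial v 1 : MvPolynomial (Fin d) K) u := by
  have hne : u ≠ v := by rintro rfl; exact NegDegRevLexLT.irrefl _ h
  refine ⟨left_mem_support_monomial_sub hne, fun m hm hmu => ?_⟩
  rcases mem_support_monomial_sub hm with rfl | rfl
  · exact (hmu rfl).elim
  · exact h

theorem isLeadingExponent_monomial_sub' {d : ℕ} {u v : Fin d →₀ ℕ} (h : NegDegRevLexLT v u) :
    IsLeadingExponent (monomial v 1 - monomial u 1 : MvPolynomial (Fin d) K) u := by
  have hne : v ≠ u := by rintro rfl; exact NegDegRevLexLT.irrefl _ h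
  refine ⟨right_mem_support_monomial_sub hne, fun m hm hmu => ?_⟩
  rcases mem_support_monomial_sub hm with rfl | rfl
  · exact h
  · exact (hmu rfl).elim

end Binomial

/-! ### Joining rewriting steps -/

namespace RewriteStep

variable {d : ℕ} {ι : Type*} {L T : ι → Fin d →₀ ℕ} {x y : Fin d →₀ ℕ}

theorem of_le (i : ι) (h : L i ≤ x) : RewriteStep L T x (x - L i + T i) :=
  ⟨i, x - L i, (add_tsub_cancel_of_le h).symm, add_comm _ _⟩

theorem join_of_right (l : ι) (hl : L l ≤ y) (h : x = y - L l + T l) :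
    Relation.Join (Relation.ReflTransGen (RewriteStep L T)) x y :=
  ⟨x, .refl, h ▸ .single (of_le l hl)⟩

theorem join_of_left (k : ι) (hk : L k ≤ x) (h : y = x - L k + T k) :
    Relation.Join (Relation.ReflTransGen (RewriteStep L T)) x y :=
  ⟨y, h ▸ .single (of_le k hk), .refl⟩

theorem join_of_both (k l : ι) (hk : L k ≤ x) (hl : L l ≤ y)
    (h : x - L k + T k = y - L l + T l) :
    Relation.Join (Relation.ReflTransGen (RewriteStep L T)) x y :=
  ⟨x - L k + T k, .single (of_le k hk), h ▸ .single (of_le l hl)⟩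

end RewriteStep

/-! ### Case 3(b) -/

namespace Case3bExponents

/-- The exponents of the leading monomials of the standard basis. -/
noncomputable def lead (e : Case3bExponents) : Fin 6 → Fin 4 →₀ ℕ :=
  ![fourExp 0 e.a12 0 e.a14, fourExp 0 0 e.a23 e.a24, fourExp 0 0 e.a3 0, fourExp 0 0 0 e.a4,
    fourExp 0 e.a12 e.a43 0, fourExp 0 (e.a2 + e.a12) 0 0]

/-- The exponents of the other monomials of the standard basis. -/
noncomputable def tail (e : Case3bExponents) : Fin 6 → Fin 4 →₀ ℕ :=
  ![fourExp e.a1 0 0 0, fourExp 0 e.a2 0 0, fourExp e.a31 e.a32 0 0, fourExp e.a41 0 e.a43 0,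
    fourExp e.a31 0 0 e.a24, fourExp e.a1 0 e.a23 (e.a24 - e.a14)]

/-- The exponents of the first monomials of the minimal generators. -/
noncomputable def genLeft (e : Case3bExponents) : Fin 5 → Fin 4 →₀ ℕ :=
  ![fourExp e.a1 0 0 0, fourExp 0 e.a2 0 0, fourExp 0 0 e.a3 0, fourExp 0 0 0 e.a4,
    fourExp e.a31 0 0 e.a24]

/-- The exponents of the second monomials of the minimal generators. -/
noncomputable def genRight (e : Case3bExponents) : Fin 5 → Fin 4 →₀ ℕ :=
  ![fourExp 0 e.a12 0 e.a14, fourExp 0 0 e.a23 e.a24, fourExp e.a31 e.a32 0 0,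
    fourExp e.a41 0 e.a43 0, fourExp 0 e.a12 e.a43 0]

/-- Positivity of the exponents in case 3(b), and the relations between them. -/
structure Relations (e : Case3bExponents) : Prop where
  a12 : 0 < e.a12
  a14 : 0 < e.a14
  a23 : 0 < e.a23
  a24 : 0 < e.a24
  a31 : 0 < e.a31
  a32 : 0 < e.a32
  a41 : 0 < e.a41
  a43 : 0 < e.a43
  a1 : e.a1 = e.a31 + e.a41
  a2 : e.a2 = e.a12 + e.a32
  a3 : e.a3 = e.a23 + e.a43
  a4 : e.a4 = e.a14 + e.a24

/-- The six rules are locally confluent. -/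
theorem Relations.locallyConfluent {e : Case3bExponents} (h : e.Relations)
    (h14 : e.a14 ≤ e.a24) (a b c : Fin 4 →₀ ℕ)
    (hb : RewriteStep e.lead e.tail a b) (hc : RewriteStep e.lead e.tail a c) :
    Relation.Join (Relation.ReflTransGen (RewriteStep e.lead e.tail)) b c := by
  obtain ⟨h12, h14', h23', h24, h31, h32, h41, h43, h1, h2, h3, h4⟩ := h
  obtain ⟨i, r, rfl, rfl⟩ := hb
  obtain ⟨j, r', heq, rfl⟩ := hc
  wlog hij : i ≤ j generalizing i j r r'
  · exact Std.Symm.symm _ _ (this j r' i r heq.symm (le_of_not_ge hij))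
  rcases hij.eq_or_lt with rfl | hij
  · rw [add_left_cancel heq]
    exact ⟨_, .refl, .refl⟩
  rw [four_ext_iff] at heq
  fin_cases i <;> fin_cases j <;> first | exact absurd hij (by decide) | skip
  all_goals simp [lead] at heq
  -- This overlap is the origin of f_6: rewriting x_2^{a_12} x_3^{a_23} x_4^{a_24} by the first two
  -- rules yields its two monomials.
  · apply RewriteStep.join_of_right 5 <;> simp [four_le_iff, four_ext_iff, lead, tail] <;> omega
  · apply RewriteStep.join_of_both 2 0 <;> simp [four_le_iff, four_ext_iff, lead, tail] <;> omega
  · apply RewriteStep.join_of_right 4 <;> simp [four_le_iff, four_ext_iff, lead, tail] <;> omega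
  · apply RewriteStep.join_of_right 3 <;> simp [four_le_iff, four_ext_iff, lead, tail] <;> omega
  · apply RewriteStep.join_of_right 1 <;> simp [four_le_iff, four_ext_iff, lead, tail] <;> omega
  · apply RewriteStep.join_of_left 4 <;> simp [four_le_iff, four_ext_iff, lead, tail] <;> omega
  · apply RewriteStep.join_of_both 0 2 <;> simp [four_le_iff, four_ext_iff, lead, tail] <;> omega
  · apply RewriteStep.join_of_both 5 3 <;> simp [four_le_iff, four_ext_iff, lead, tail] <;> omega
  · apply RewriteStep.join_of_both 5 1 <;> simp [four_le_iff, four_ext_iff, lead, tail] <;> omega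
  · apply RewriteStep.join_of_both 3 2 <;> simp [four_le_iff, four_ext_iff, lead, tail] <;> omega
  · apply RewriteStep.join_of_right 1 <;> simp [four_le_iff, four_ext_iff, lead, tail] <;> omega
  · apply RewriteStep.join_of_both 5 2 <;> simp [four_le_iff, four_ext_iff, lead, tail] <;> omega
  · apply RewriteStep.join_of_both 4 3 <;> simp [four_le_iff, four_ext_iff, lead, tail] <;> omega
  · apply RewriteStep.join_of_both 5 3 <;> simp [four_le_iff, four_ext_iff, lead, tail] <;> omega
  · apply RewriteStep.join_of_both 0 2 <;> simp [four_le_iff, four_ext_iff, lead, tail] <;> omega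

end Case3bExponents

namespace Case3bExponents

variable {K : Type*} [Field K] {n : Fin 4 → ℕ} {e : Case3bExponents}

theorem toricIdeal_eq_span (hC : IsCase3b K n e) :
    toricIdeal K n = Ideal.span (Set.range fun i =>
      monomial (e.genLeft i) (1 : K) - monomial (e.genRight i) 1) := by
  rw [← hC.minimallyGenerated.1]
  congr 2
  funext i
  fin_cases i <;> simp [genLeft, genRight, monomial_fourExp]

theorem weight_gen_eq (hC : IsCase3b K n e) (i : Fin 5) :
    Finsupp.weight n (e.genLeft i) = Finsupp.weight n (e.genRight i) := by
  rw [← monomial_sub_monomial_mem_toricIdeal (K := K), toricIdeal_eq_span hC]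
  exact Ideal.subset_span ⟨i, rfl⟩

/-- The weighted degrees of the two monomials of each generator agree. -/
structure WeightRelations (n : Fin 4 → ℕ) (e : Case3bExponents) : Prop where
  f1 : e.a1 * n 0 = e.a12 * n 1 + e.a14 * n 3
  f2 : e.a2 * n 1 = e.a23 * n 2 + e.a24 * n 3
  f3 : e.a3 * n 2 = e.a31 * n 0 + e.a32 * n 1
  f4 : e.a4 * n 3 = e.a41 * n 0 + e.a43 * n 2
  f5 : e.a31 * n 0 + e.a24 * n 3 = e.a12 * n 1 + e.a43 * n 2

theorem weightRelations (hC : IsCase3b K n e) : e.WeightRelations n where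
  f1 := by simpa [genLeft, genRight, weight_fourExp] using weight_gen_eq hC 0
  f2 := by simpa [genLeft, genRight, weight_fourExp] using weight_gen_eq hC 1
  f3 := by simpa [genLeft, genRight, weight_fourExp] using weight_gen_eq hC 2
  f4 := by simpa [genLeft, genRight, weight_fourExp] using weight_gen_eq hC 3
  f5 := by simpa [genLeft, genRight, weight_fourExp] using weight_gen_eq hC 4

/-- The monomials of the minimal generators generate a monomial ideal that contains `I(C)`. -/
theorem exists_le_of_mem_toricIdeal (hC : IsCase3b K n e) :
    ∀ f ∈ toricIdeal K n, ∀ u ∈ f.support,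
      ∃ m ∈ Set.range e.genLeft ∪ Set.range e.genRight, m ≤ u := by
  intro f hf
  rw [toricIdeal_eq_span hC] at hf
  refine exists_le_of_mem_span ?_ hf
  rintro _ ⟨i, rfl⟩ u hu
  rcases mem_support_monomial_sub hu with rfl | rfl
  · exact ⟨_, .inl ⟨i, rfl⟩, le_rfl⟩
  · exact ⟨_, .inr ⟨i, rfl⟩, le_rfl⟩

/-- An exponent below no exponent of the minimal generators is the only one of its weight. -/
theorem eq_of_weight_eq (hC : IsCase3b K n e) {u v : Fin 4 →₀ ℕ}
    (hL : ∀ i, ¬ e.genLeft i ≤ u) (hR : ∀ i, ¬ e.genRight i ≤ u)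
    (h : Finsupp.weight n u = Finsupp.weight n v) : u = v := by
  by_contra hne
  obtain ⟨_, ⟨i, rfl⟩ | ⟨i, rfl⟩, hm⟩ := exists_le_of_mem_toricIdeal hC _
    (monomial_sub_monomial_mem_toricIdeal.mpr h) u (left_mem_support_monomial_sub hne)
  · exact hL i hm
  · exact hR i hm

/-- Otherwise the difference of A and C would be a positive number below N whose multiple of x is a
multiple of y. -/
theorem eq_and_eq_of_mul_add_mul_eq {N x y A B C D : ℕ} (hy : 0 < y)
    (hmin : ∀ c d, c < N → c * x = d * y → c = 0) (hA : A < C + N) (hC : C < A + N)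
    (h : A * x + B * y = C * x + D * y) : A = C ∧ B = D := by
  have main : ∀ A B C D : ℕ, A < C + N → C ≤ A → A * x + B * y = C * x + D * y → A = C := by
    intro A B C D hA hCA h
    obtain ⟨c, rfl⟩ := Nat.exists_eq_add_of_le hCA
    have h' : c * x + B * y = D * y := by
      rw [add_mul] at h; omega
    have hBD : B ≤ D := Nat.le_of_mul_le_mul_right (by omega) hy
    obtain ⟨d, rfl⟩ := Nat.exists_eq_add_of_le hBD
    have := hmin c d (by omega) (by rw [add_mul] at h'; omega)
    omega
  have hAC : A = C := by
    rcases le_total C A with h1 | h1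
    · exact main A B C D hA h1 h
    · exact (main C D A B hC h1 h.symm).symm
  refine ⟨hAC, ?_⟩
  subst hAC
  exact Nat.eq_of_mul_eq_mul_right hy (by omega)

/-- Adding the weight equations of f_1 and f_4 and substituting that of f_5 leaves an equation in
n_1 and n_4 only; f_2, f_3 and f_5 give one in n_2 and n_3. A power x_1^c with c < a_1, or x_2^c
with c < a_2, is divisible by no monomial of the generators, so `eq_of_weight_eq` provides the
minimality that lets coefficients be compared. -/
theorem relations (hC : IsCase3b K n e) (hpos : 0 < n 0) (hn : StrictMono n) : e.Relations := by
  obtain ⟨p12, p14, p23, p24, p31, p32, p41, p43, -⟩ := id hC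
  obtain ⟨w1, w2, w3, w4, w5⟩ := weightRelations hC
  have l1 : n 0 < n 1 := hn (by decide)
  have l2 : n 1 < n 2 := hn (by decide)
  have l3 : n 2 < n 3 := hn (by decide)
  have hmin0 : ∀ c d, c < e.a1 → c * n 0 = d * n 3 → c = 0 := by
    intro c d hc h
    have := eq_of_weight_eq hC (u := fourExp c 0 0 0) (v := fourExp 0 0 0 d)
      (by intro i; fin_cases i <;> simp [genLeft, four_le_iff] <;> omega)
      (by intro i; fin_cases i <;> simp [genRight, four_le_iff] <;> omega)
      (by simpa [weight_fourExp] using h)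
    exact (four_ext_iff.mp this).1
  have hmin1 : ∀ c d, c < e.a2 → c * n 1 = d * n 2 → c = 0 := by
    intro c d hc h
    have := eq_of_weight_eq hC (u := fourExp 0 c 0 0) (v := fourExp 0 0 d 0)
      (by intro i; fin_cases i <;> simp [genLeft, four_le_iff] <;> omega)
      (by intro i; fin_cases i <;> simp [genRight, four_le_iff] <;> omega)
      (by simpa [weight_fourExp] using h)
    exact (four_ext_iff.mp this).2.1
  have r1 := eq_and_eq_of_mul_add_mul_eq (A := e.a1) (B := e.a4) (C := e.a31 + e.a41)
    (D := e.a14 + e.a24) (by omega) hmin0 (by omega) (by omega) (by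
      simp only [add_mul]; omega)
  have r2 := eq_and_eq_of_mul_add_mul_eq (A := e.a2) (B := e.a3) (C := e.a12 + e.a32)
    (D := e.a23 + e.a43) (by omega) hmin1 (by omega) (by omega) (by
      simp only [add_mul]; omega)
  exact ⟨p12.1, p14.1, p23.1, p24.1, p31.1, p32.1, p41.1, p43.1, r1.1, r2.1, r2.2, r1.2⟩

theorem lt_add_of_mul_eq {x y z a b c : ℕ} (hxy : x ≤ y) (hxz : x < z) (hc : 0 < c)
    (h : a * x = b * y + c * z) : b + c < a := by
  by_contra! hle
  have h1 : a * x ≤ (b + c) * x := Nat.mul_le_mul_right _ hle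
  have h2 : b * x ≤ b * y := Nat.mul_le_mul_left _ hxy
  have h3 : c * x < c * z := Nat.mul_lt_mul_of_pos_left hxz hc
  rw [add_mul] at h1
  omega

theorem add_lt_of_mul_eq {x y z a b c : ℕ} (hyx : y < x) (hzx : z ≤ x) (hb : 0 < b)
    (h : a * x = b * y + c * z) : a < b + c := by
  by_contra! hle
  have h1 : (b + c) * x ≤ a * x := Nat.mul_le_mul_right _ hle
  have h2 : b * y < b * x := Nat.mul_lt_mul_of_pos_left hyx hb
  have h3 : c * z ≤ c * x := Nat.mul_le_mul_left _ hzx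
  rw [add_mul] at h1
  omega

/-- The inequalities between the degrees of the two monomials of the elements of the standard
basis. -/
structure DegreeRelations (e : Case3bExponents) : Prop where
  f1 : e.a12 + e.a14 < e.a1
  f2 : e.a23 + e.a24 < e.a2
  f3 : e.a3 < e.a31 + e.a32
  f4 : e.a4 < e.a41 + e.a43
  f5 : e.a12 + e.a43 ≤ e.a31 + e.a24
  f6 : e.a2 + e.a12 ≤ e.a1 + e.a23 + (e.a24 - e.a14)

theorem weight_lead_eq (hC : IsCase3b K n e) (h14 : e.a14 ≤ e.a24) (i : Fin 6) :
    Finsupp.weight n (e.lead i) = Finsupp.weight n (e.tail i) := by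
  obtain ⟨w1, w2, w3, w4, w5⟩ := weightRelations hC
  obtain ⟨c, hc⟩ := Nat.exists_eq_add_of_le h14
  have hc' : e.a24 - e.a14 = c := by omega
  have w2' : e.a2 * n 1 = e.a23 * n 2 + (e.a14 * n 3 + c * n 3) := by rw [w2, hc, add_mul]
  fin_cases i <;> simp [lead, tail, weight_fourExp, hc', add_mul] <;> omega

theorem degreeRelations (hC : IsCase3b K n e) (hpos : 0 < n 0) (hn : StrictMono n)
    (hCM : HasCohenMacaulayTangentCone K n) (h14 : e.a14 ≤ e.a24) : e.DegreeRelations := by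
  obtain ⟨p12, p14, p23, p24, p31, p32, p41, p43, -⟩ := id hC
  obtain ⟨w1, w2, w3, w4, w5⟩ := weightRelations hC
  have l1 : n 0 < n 1 := hn (by decide)
  have l2 : n 1 < n 2 := hn (by decide)
  have l3 : n 2 < n 3 := hn (by decide)
  have hmin : ∀ i, i ≠ 0 → n 0 < n i := fun i hi => hn (Fin.pos_of_ne_zero hi)
  have cone : ∀ u v : Fin 4 →₀ ℕ, Finsupp.weight n u = Finsupp.weight n v → u.degree < v.degree →
      monomial u 1 ∈ tangentConeIdeal (toricIdeal K n) := fun u v hw hd => by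
    rw [← leastForm_monomial_sub_of_lt hd]
    exact Ideal.subset_span
      (Set.mem_image_of_mem _ (monomial_sub_monomial_mem_toricIdeal.mpr hw))
  refine ⟨lt_add_of_mul_eq (by omega) (by omega) p14.1 w1,
    lt_add_of_mul_eq (by omega) (by omega) p24.1 w2,
    add_lt_of_mul_eq (by omega) (by omega) p31.1 w3,
    add_lt_of_mul_eq (by omega) (by omega) p41.1 w4, ?_, ?_⟩
  -- Cancelling x_1^{a_31} from the tail of f_5 would leave x_4^{a_24}, too small a power since a_24
  -- < a_4.
  · by_contra! hlt
    have h := cone (e.tail 4) (e.lead 4) (weight_lead_eq hC h14 4).symm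
      (by simp [lead, tail, degree_fourExp]; omega)
    obtain ⟨_, ⟨i, rfl⟩ | ⟨i, rfl⟩, hm⟩ := exists_le_of_add_single_mem_tangentConeIdeal hCM hpos
      hmin (exists_le_of_mem_toricIdeal hC) (k := e.a31) (u := fourExp 0 0 0 e.a24) (by
        simpa [tail, monomial_fourExp] using h)
    all_goals
      rw [four_le_iff] at hm
      fin_cases i <;> simp [genLeft, genRight] at hm <;> omega
  -- Here cancelling x_1^{a_1} would leave x_3^{a_23} x_4^{a_24 - a_14}, excluded by a_23 < a_3,
  -- a_24 < a_4 and 0 < a_14.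
  · by_contra! hlt
    have h := cone (e.tail 5) (e.lead 5) (weight_lead_eq hC h14 5).symm
      (by simp [lead, tail, degree_fourExp]; omega)
    obtain ⟨_, ⟨i, rfl⟩ | ⟨i, rfl⟩, hm⟩ := exists_le_of_add_single_mem_tangentConeIdeal hCM hpos
      hmin (exists_le_of_mem_toricIdeal hC) (k := e.a1)
      (u := fourExp 0 0 e.a23 (e.a24 - e.a14)) (by
        simpa [tail, monomial_fourExp, mul_assoc] using h)
    all_goals
      rw [four_le_iff] at hm
      fin_cases i <;> simp [genLeft, genRight] at hm <;> omega

theorem Relations.tail_lt_lead (h : e.Relations) (hd : e.DegreeRelations) (i : Fin 6) :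
    NegDegRevLexLT (e.tail i) (e.lead i) := by
  obtain ⟨h12, h14', h23', h24, h31, h32, h41, h43, h1, h2, h3, h4⟩ := h
  obtain ⟨d1, d2, d3, d4, d5, d6⟩ := hd
  unfold NegDegRevLexLT
  fin_cases i
  · left; simp [lead, tail, degree_fourExp]; omega
  · left; simp [lead, tail, degree_fourExp]; omega
  · left; simp [lead, tail, degree_fourExp]; omega
  · left; simp [lead, tail, degree_fourExp]; omega
  -- At equal degree the smallest variable x_1 decides: it occurs in the tail and not in the leading
  -- monomial.
  · rcases d5.lt_or_eq with d5 | d5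
    · left; simp [lead, tail, degree_fourExp]; omega
    · exact .inr ⟨by simp [lead, tail, degree_fourExp]; omega, 0, by simp, by simp [lead, tail]; omega⟩
  · rcases d6.lt_or_eq with d6 | d6
    · left; simp [lead, tail, degree_fourExp]; omega
    · exact .inr ⟨by simp [lead, tail, degree_fourExp]; omega, 0, by simp, by simp [lead, tail]; omega⟩

/-- Rewriting terminates: each rule raises the first exponent, or keeps it and raises the second,
and both are bounded by the weight. -/
theorem Relations.wellFounded (h : e.Relations) (hn : ∀ i, 0 < n i)
    (hw : ∀ i, Finsupp.weight n (e.lead i) = Finsupp.weight n (e.tail i)) :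
    WellFounded (flip (RewriteStep e.lead e.tail)) := by
  obtain ⟨h12, h14', h23', h24, h31, h32, h41, h43, h1, h2, h3, h4⟩ := h
  -- The weight is invariant and bounds every coordinate, so the truncated subtractions are exact.
  let F : (Fin 4 →₀ ℕ) → ℕ ×ₗ ℕ := fun u =>
    toLex (Finsupp.weight n u - u 0, Finsupp.weight n u - u 1)
  refine Subrelation.wf (r := InvImage (· < ·) F) ?_ (InvImage.wf F wellFounded_lt)
  intro v u huv
  have hle : ∀ i, v i ≤ Finsupp.weight n v := fun i => Finsupp.le_weight n (hn i).ne' v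
  have hle0 := hle 0
  have hle1 := hle 1
  obtain ⟨i, r, rfl, rfl⟩ := huv
  have hwr : Finsupp.weight n (e.lead i + r) = Finsupp.weight n (e.tail i + r) := by
    rw [map_add, map_add, hw]
  change F _ < F _
  simp only [F, Prod.Lex.toLex_lt_toLex, hwr]
  generalize Finsupp.weight n (e.tail i + r) = w at hle0 hle1
  fin_cases i <;> simp [lead, tail] at hle0 hle1 ⊢ <;> omega

theorem genLeft_join_genRight (i : Fin 5) :
    Relation.Join (Relation.ReflTransGen (RewriteStep e.lead e.tail)) (e.genLeft i)
      (e.genRight i) := by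
  fin_cases i
  · exact ⟨_, .refl, .single (RewriteStep.rule 0)⟩
  · exact ⟨_, .refl, .single (RewriteStep.rule 1)⟩
  · exact ⟨_, .single (RewriteStep.rule 2), .refl⟩
  · exact ⟨_, .single (RewriteStep.rule 3), .refl⟩
  · exact ⟨_, .refl, .single (RewriteStep.rule 4)⟩

theorem exists_nf (hC : IsCase3b K n e) (hpos : 0 < n 0) (hn : StrictMono n)
    (h14 : e.a14 ≤ e.a24) :
    ∃ nf : ℕ → (Fin 4 →₀ ℕ), ∀ u,
      Relation.ReflTransGen (RewriteStep e.lead e.tail) u (nf (Finsupp.weight n u)) :=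
  have hrel := relations hC hpos hn
  exists_normalForm (toricIdeal_eq_span hC) genLeft_join_genRight
    (hrel.wellFounded (fun i => hpos.trans_le (hn.monotone (Fin.zero_le i)))
      (weight_lead_eq hC h14))
    (hrel.locallyConfluent h14)

/-- The tangent cone ideal, with the least forms `p` and `q` of `f_5` and `f_6`. -/
theorem isMinimallyGeneratedBy_tangentConeIdeal (hC : IsCase3b K n e) (hpos : 0 < n 0)
    (hn : StrictMono n) (hCM : HasCohenMacaulayTangentCone K n) (h14 : e.a14 ≤ e.a24)
    {p q : MvPolynomial (Fin 4) K}
    (hp : e.a12 + e.a43 < e.a31 + e.a24 ∧ p = monomial (e.lead 4) 1 ∨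
      e.a12 + e.a43 = e.a31 + e.a24 ∧ p = monomial (e.tail 4) 1 - monomial (e.lead 4) 1)
    (hq : e.a2 + e.a12 < e.a1 + e.a23 + (e.a24 - e.a14) ∧ q = monomial (e.lead 5) 1 ∨
      e.a2 + e.a12 = e.a1 + e.a23 + (e.a24 - e.a14) ∧
        q = monomial (e.lead 5) 1 - monomial (e.tail 5) 1) :
    IsMinimallyGeneratedBy (tangentConeIdeal (toricIdeal K n))
      ![monomial (e.lead 0) 1, monomial (e.lead 1) 1, monomial (e.lead 2) 1,
        monomial (e.lead 3) 1, p, q] := by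
  obtain ⟨d1, d2, d3, d4, -, -⟩ := degreeRelations hC hpos hn hCM h14
  have hrel := relations hC hpos hn
  obtain ⟨nf, hnf⟩ := exists_nf hC hpos hn h14
  set g : Fin 6 → MvPolynomial (Fin 4) K := ![monomial (e.lead 0) 1, monomial (e.lead 1) 1,
    monomial (e.lead 2) 1, monomial (e.lead 3) 1, p, q] with hg
  have deg : ∀ i, (e.lead i).degree = (![e.a12 + e.a14, e.a23 + e.a24, e.a3, e.a4,
      e.a12 + e.a43, e.a2 + e.a12] : Fin 6 → ℕ) i ∧
      (e.tail i).degree = (![e.a1, e.a2, e.a31 + e.a32, e.a41 + e.a43, e.a31 + e.a24,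
      e.a1 + e.a23 + (e.a24 - e.a14)] : Fin 6 → ℕ) i := by
    intro i; fin_cases i <;> simp [lead, tail, degree_fourExp]
  have mem : ∀ i, (monomial (e.lead i) 1 - monomial (e.tail i) 1 : MvPolynomial (Fin 4) K) ∈
      toricIdeal K n := fun i => monomial_sub_monomial_mem_toricIdeal.mpr (weight_lead_eq hC h14 i)
  have hne : ∀ i, e.lead i ≠ e.tail i := by
    obtain ⟨h12, h14', h23', h24, h31, h32, h41, h43, h1, h2, h3, h4⟩ := hrel
    intro i
    rw [Ne, four_ext_iff]
    fin_cases i <;> simp [lead, tail] <;> omega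
  -- The sign accounts for f_5, whose leading monomial is written second.
  have hform : ∀ i, (e.lead i).degree < (e.tail i).degree ∧ g i = monomial (e.lead i) 1 ∨
      (e.lead i).degree = (e.tail i).degree ∧
        (g i = monomial (e.lead i) 1 - monomial (e.tail i) 1 ∨
          g i = -(monomial (e.lead i) 1 - monomial (e.tail i) 1)) := by
    intro i
    rw [(deg i).1, (deg i).2]
    fin_cases i
    · exact .inl ⟨d1, rfl⟩
    · exact .inl ⟨d2, rfl⟩
    · exact .inl ⟨d3, rfl⟩
    · exact .inl ⟨d4, rfl⟩
    · rcases hp with ⟨h, rfl⟩ | ⟨h, rfl⟩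
      · exact .inl ⟨h, rfl⟩
      · exact .inr ⟨h, .inr (neg_sub _ _).symm⟩
    · rcases hq with ⟨h, rfl⟩ | ⟨h, rfl⟩
      · exact .inl ⟨h, rfl⟩
      · exact .inr ⟨h, .inl rfl⟩
  have hlead : ∀ i, e.lead i ∈ (g i).support := by
    intro i
    rcases hform i with ⟨-, h⟩ | ⟨-, h | h⟩ <;> rw [h]
    · simp [mem_support_iff]
    · exact left_mem_support_monomial_sub (hne i)
    · rw [neg_sub]
      exact right_mem_support_monomial_sub (hne i).symm
  constructor
  · apply le_antisymm
    · rw [Ideal.span_le]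
      rintro _ ⟨i, rfl⟩
      have hlf := Ideal.subset_span (Set.mem_image_of_mem leastForm (mem i))
      rcases hform i with ⟨hd, h⟩ | ⟨hd, h⟩
      · rw [leastForm_monomial_sub_of_lt hd] at hlf
        rw [h]; exact hlf
      · rw [leastForm_monomial_sub_of_eq hd] at hlf
        rcases h with h | h <;> rw [h]
        · exact hlf
        · exact neg_mem hlf
    · refine tangentConeIdeal_toricIdeal_le hnf fun i => ?_
      have hgi : g i ∈ Ideal.span (Set.range g) := Ideal.subset_span ⟨i, rfl⟩
      rcases hform i with ⟨hd, h⟩ | ⟨hd, h | h⟩ <;> rw [h] at hgi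
      · exact .inl ⟨hd, hgi⟩
      · exact .inr ⟨hd, hgi⟩
      · exact .inr ⟨hd, neg_mem_iff.mp hgi⟩
  -- No leading monomial divides another, and none is divisible by the tail of f_5 or f_6, since
  -- these contain x_1. The tails can therefore be admitted in all cases at once.
  · refine notMem_span_image_of_support
      ![{e.lead 0}, {e.lead 1}, {e.lead 2}, {e.lead 3}, {e.lead 4, e.tail 4},
        {e.lead 5, e.tail 5}] ?_ e.lead hlead ?_
    · intro i u hu
      fin_cases i
      · exact Finset.mem_singleton.mp (support_monomial_subset hu)
      · exact Finset.mem_singleton.mp (support_monomial_subset hu)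
      · exact Finset.mem_singleton.mp (support_monomial_subset hu)
      · exact Finset.mem_singleton.mp (support_monomial_subset hu)
      · rcases hp with ⟨-, rfl⟩ | ⟨-, rfl⟩
        · exact .inl (Finset.mem_singleton.mp (support_monomial_subset hu))
        · exact (mem_support_monomial_sub hu).symm
      · rcases hq with ⟨-, rfl⟩ | ⟨-, rfl⟩
        · exact .inl (Finset.mem_singleton.mp (support_monomial_subset hu))
        · exact mem_support_monomial_sub hu
    · obtain ⟨h12, h14', h23', h24, h31, h32, h41, h43, h1, h2, h3, h4⟩ := hrel
      intro i j hji m hm hle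
      rw [four_le_iff] at hle
      fin_cases j <;> simp at hm
      all_goals
        try rcases hm with rfl | rfl
      all_goals
        fin_cases i <;> simp [lead, tail] at hle hji <;> omega

theorem isStandardBasis (hC : IsCase3b K n e) (hpos : 0 < n 0) (hn : StrictMono n)
    (hCM : HasCohenMacaulayTangentCone K n) (h14 : e.a14 ≤ e.a24) :
    IsStandardBasis (toricIdeal K n)
      {monomial (e.tail 0) 1 - monomial (e.lead 0) 1, monomial (e.tail 1) 1 - monomial (e.lead 1) 1,
        monomial (e.lead 2) 1 - monomial (e.tail 2) 1,
        monomial (e.lead 3) 1 - monomial (e.tail 3) 1,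
        monomial (e.tail 4) 1 - monomial (e.lead 4) 1,
        monomial (e.lead 5) 1 - monomial (e.tail 5) 1} := by
  have hlt := (relations hC hpos hn).tail_lt_lead (degreeRelations hC hpos hn hCM h14)
  obtain ⟨nf, hnf⟩ := exists_nf hC hpos hn h14
  have hw := weight_lead_eq hC h14
  refine ⟨Set.toFinite _, ?mem, leadingIdeal_toricIdeal_eq hlt hnf ?mem fun i => ?lead⟩
  case mem =>
    rintro _ (rfl | rfl | rfl | rfl | rfl | rfl)
    · exact monomial_sub_monomial_mem_toricIdeal.mpr (hw 0).symm
    · exact monomial_sub_monomial_mem_toricIdeal.mpr (hw 1).symm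
    · exact monomial_sub_monomial_mem_toricIdeal.mpr (hw 2)
    · exact monomial_sub_monomial_mem_toricIdeal.mpr (hw 3)
    · exact monomial_sub_monomial_mem_toricIdeal.mpr (hw 4).symm
    · exact monomial_sub_monomial_mem_toricIdeal.mpr (hw 5)
  case lead =>
    fin_cases i
    · exact ⟨_, .inl rfl, isLeadingExponent_monomial_sub' (hlt 0)⟩
    · exact ⟨_, .inr (.inl rfl), isLeadingExponent_monomial_sub' (hlt 1)⟩
    · exact ⟨_, .inr (.inr (.inl rfl)), isLeadingExponent_monomial_sub (hlt 2)⟩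
    · exact ⟨_, .inr (.inr (.inr (.inl rfl))), isLeadingExponent_monomial_sub (hlt 3)⟩
    · exact ⟨_, .inr (.inr (.inr (.inr (.inl rfl)))), isLeadingExponent_monomial_sub' (hlt 4)⟩
    · exact ⟨_, .inr (.inr (.inr (.inr (.inr rfl)))), isLeadingExponent_monomial_sub (hlt 5)⟩

end Case3bExponents

theorem theorem2p23 {K : Type*} [Field K] (n : Fin 4 → ℕ) (hpos : 0 < n 0) (hn : StrictMono n)
    (hgcd : Finset.univ.gcd n = 1) (e : Case3bExponents) (hC : IsCase3b K n e)
    (hCM : HasCohenMacaulayTangentCone K n) (h23 : e.a23 < e.a43) (h14 : e.a14 ≤ e.a24) :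
    IsStandardBasis (toricIdeal K n)
      {X 0 ^ e.a1 - X 1 ^ e.a12 * X 3 ^ e.a14,
       X 1 ^ e.a2 - X 2 ^ e.a23 * X 3 ^ e.a24,
       X 2 ^ e.a3 - X 0 ^ e.a31 * X 1 ^ e.a32,
       X 3 ^ e.a4 - X 0 ^ e.a41 * X 2 ^ e.a43,
       X 0 ^ e.a31 * X 3 ^ e.a24 - X 1 ^ e.a12 * X 2 ^ e.a43,
       X 1 ^ (e.a2 + e.a12) - X 0 ^ e.a1 * X 2 ^ e.a23 * X 3 ^ (e.a24 - e.a14)} ∧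
    (e.a3 < e.a31 + e.a32 →
      e.a2 + e.a12 < e.a1 + e.a23 + (e.a24 - e.a14) →
      e.a12 + e.a43 < e.a31 + e.a24 →
      IsMinimallyGeneratedBy (tangentConeIdeal (toricIdeal K n))
        ![X 1 ^ e.a12 * X 3 ^ e.a14,
          X 2 ^ e.a23 * X 3 ^ e.a24,
          X 2 ^ e.a3,
          X 3 ^ e.a4,
          X 1 ^ e.a12 * X 2 ^ e.a43,
          X 1 ^ (e.a2 + e.a12)]) ∧
    (e.a3 < e.a31 + e.a32 →
      e.a2 + e.a12 < e.a1 + e.a23 + (e.a24 - e.a14) →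
      e.a12 + e.a43 = e.a31 + e.a24 →
      IsMinimallyGeneratedBy (tangentConeIdeal (toricIdeal K n))
        ![X 1 ^ e.a12 * X 3 ^ e.a14,
          X 2 ^ e.a23 * X 3 ^ e.a24,
          X 2 ^ e.a3,
          X 3 ^ e.a4,
          X 0 ^ e.a31 * X 3 ^ e.a24 - X 1 ^ e.a12 * X 2 ^ e.a43,
          X 1 ^ (e.a2 + e.a12)]) ∧
    (e.a3 < e.a31 + e.a32 →
      e.a2 + e.a12 = e.a1 + e.a23 + (e.a24 - e.a14) →
      e.a12 + e.a43 < e.a31 + e.a24 →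
      IsMinimallyGeneratedBy (tangentConeIdeal (toricIdeal K n))
        ![X 1 ^ e.a12 * X 3 ^ e.a14,
          X 2 ^ e.a23 * X 3 ^ e.a24,
          X 2 ^ e.a3,
          X 3 ^ e.a4,
          X 1 ^ e.a12 * X 2 ^ e.a43,
          X 1 ^ (e.a2 + e.a12) - X 0 ^ e.a1 * X 2 ^ e.a23 * X 3 ^ (e.a24 - e.a14)]) ∧
    (e.a3 < e.a31 + e.a32 →
      e.a2 + e.a12 = e.a1 + e.a23 + (e.a24 - e.a14) →
      e.a12 + e.a43 = e.a31 + e.a24 →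
      IsMinimallyGeneratedBy (tangentConeIdeal (toricIdeal K n))
        ![X 1 ^ e.a12 * X 3 ^ e.a14,
          X 2 ^ e.a23 * X 3 ^ e.a24,
          X 2 ^ e.a3,
          X 3 ^ e.a4,
          X 0 ^ e.a31 * X 3 ^ e.a24 - X 1 ^ e.a12 * X 2 ^ e.a43,
          X 1 ^ (e.a2 + e.a12) - X 0 ^ e.a1 * X 2 ^ e.a23 * X 3 ^ (e.a24 - e.a14)]) ∧
    (e.a3 = e.a31 + e.a32 →
      e.a2 + e.a12 < e.a1 + e.a23 + (e.a24 - e.a14) →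
      e.a12 + e.a43 < e.a31 + e.a24 →
      IsMinimallyGeneratedBy (tangentConeIdeal (toricIdeal K n))
        ![X 1 ^ e.a12 * X 3 ^ e.a14,
          X 2 ^ e.a23 * X 3 ^ e.a24,
          X 2 ^ e.a3,
          X 3 ^ e.a4,
          X 1 ^ e.a12 * X 2 ^ e.a43,
          X 1 ^ (e.a2 + e.a12)]) ∧
    (e.a3 = e.a31 + e.a32 →
      e.a2 + e.a12 < e.a1 + e.a23 + (e.a24 - e.a14) →
      e.a12 + e.a43 = e.a31 + e.a24 →
      IsMinimallyGeneratedBy (tangentConeIdeal (toricIdeal K n))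
        ![X 1 ^ e.a12 * X 3 ^ e.a14,
          X 2 ^ e.a23 * X 3 ^ e.a24,
          X 2 ^ e.a3,
          X 3 ^ e.a4,
          X 0 ^ e.a31 * X 3 ^ e.a24 - X 1 ^ e.a12 * X 2 ^ e.a43,
          X 1 ^ (e.a2 + e.a12)]) ∧
    (e.a3 = e.a31 + e.a32 →
      e.a2 + e.a12 = e.a1 + e.a23 + (e.a24 - e.a14) →
      e.a12 + e.a43 < e.a31 + e.a24 →
      IsMinimallyGeneratedBy (tangentConeIdeal (toricIdeal K n))
        ![X 1 ^ e.a12 * X 3 ^ e.a14,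
          X 2 ^ e.a23 * X 3 ^ e.a24,
          X 2 ^ e.a3,
          X 3 ^ e.a4,
          X 1 ^ e.a12 * X 2 ^ e.a43,
          X 1 ^ (e.a2 + e.a12) - X 0 ^ e.a1 * X 2 ^ e.a23 * X 3 ^ (e.a24 - e.a14)]) ∧
    (e.a3 = e.a31 + e.a32 →
      e.a2 + e.a12 = e.a1 + e.a23 + (e.a24 - e.a14) →
      e.a12 + e.a43 = e.a31 + e.a24 →
      IsMinimallyGeneratedBy (tangentConeIdeal (toricIdeal K n))
        ![X 1 ^ e.a12 * X 3 ^ e.a14,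
          X 2 ^ e.a23 * X 3 ^ e.a24,
          X 2 ^ e.a3,
          X 3 ^ e.a4,
          X 0 ^ e.a31 * X 3 ^ e.a24 - X 1 ^ e.a12 * X 2 ^ e.a43,
          X 1 ^ (e.a2 + e.a12) - X 0 ^ e.a1 * X 2 ^ e.a23 * X 3 ^ (e.a24 - e.a14)]) := by
  have hd3 := (Case3bExponents.degreeRelations hC hpos hn hCM h14).f3
  have hlead : ∀ i, (monomial (e.lead i) 1 : MvPolynomial (Fin 4) K) =
      (![X 1 ^ e.a12 * X 3 ^ e.a14, X 2 ^ e.a23 * X 3 ^ e.a24, X 2 ^ e.a3, X 3 ^ e.a4,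
        X 1 ^ e.a12 * X 2 ^ e.a43, X 1 ^ (e.a2 + e.a12)] : Fin 6 → MvPolynomial (Fin 4) K) i := by
    intro i
    fin_cases i <;> simp [Case3bExponents.lead, monomial_fourExp]
  have htail : ∀ i, (monomial (e.tail i) 1 : MvPolynomial (Fin 4) K) =
      (![X 0 ^ e.a1, X 1 ^ e.a2, X 0 ^ e.a31 * X 1 ^ e.a32, X 0 ^ e.a41 * X 2 ^ e.a43,
        X 0 ^ e.a31 * X 3 ^ e.a24, X 0 ^ e.a1 * X 2 ^ e.a23 * X 3 ^ (e.a24 - e.a14)] :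
        Fin 6 → MvPolynomial (Fin 4) K) i := by
    intro i
    fin_cases i <;> simp [Case3bExponents.tail, monomial_fourExp]
  have hbasis := Case3bExponents.isStandardBasis hC hpos hn hCM h14
  have hcone := fun p q => Case3bExponents.isMinimallyGeneratedBy_tangentConeIdeal (p := p) (q := q)
    hC hpos hn hCM h14
  simp only [hlead, htail] at hbasis hcone
  refine ⟨hbasis, ?_, ?_, ?_, ?_, ?_, ?_, ?_, ?_⟩ <;> intro h3 h6 h5
  · exact hcone _ _ (.inl ⟨h5, rfl⟩) (.inl ⟨h6, rfl⟩)
  · exact hcone _ _ (.inr ⟨h5, rfl⟩) (.inl ⟨h6, rfl⟩)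
  · exact hcone _ _ (.inl ⟨h5, rfl⟩) (.inr ⟨h6, rfl⟩)
  · exact hcone _ _ (.inr ⟨h5, rfl⟩) (.inr ⟨h6, rfl⟩)
  -- The remaining cases assume a_3 = a_31 + a_32, against the strict inequality forced by n_1 < n_2
  -- < n_3.
  all_goals exact absurd h3 hd3.ne
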